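/- Let $e$, $f$, $p>1$, $q>1$, $r>2$, $u>1$, $v>1$ be positive integers and put $E=e\,p^2q^4r^8$. Write $(z;x)_n=\prod_{k=0}^{n-1}(1-zx^k)$, and let $[0;\overline{a_1(n),\dots,a_{24}(n)}]_{n=1}^{\infty}$ denote the regular continued fraction whose partial quotients after the leading $0$ are $a_1(1),\dots,a_{24}(1),a_1(2),\dots,a_{24}(2),\dots$. Then the continued fraction below has positive integer partial quotients and converges, both series on the right converge, the second one to a non-zero value, and $$ \begin{aligned} [0;\ \overline{&r-1,\,1,\,q-1,\,r,\,p-1,\,1,\,r-1,\,q-1,\,1,\,r-1,\,eu^n-1,\,1,}\\ &\overline{r-2,\,1,\,q-1,\,r-1,\,1,\,p-1,\,r,\,q-1,\,1,\,r-2,\,1,\,fv^n-1}\ ]_{n=1}^{\infty}\\ &=\frac{1}{pq^2r^4}+\frac{1}{qr^2}+\frac1r+\frac{1}{Eu}-\frac{1}{E^2fu^2v+E}\cdot \frac{\displaystyle\sum_{n=0}^{\infty}\frac{(Ef)^{-n}(uv)^{-n(n+3)/2}}{\left(\frac1{uv};\frac1{uv}\right)_n\left(-\frac{1}{Efu^3v^2};\frac1{uv}\right)_n}}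 {\displaystyle\sum_{n=0}^{\infty}\frac{(Ef)^{-n}(uv)^{-n(n+1)/2}}{\left(\frac1{uv};\frac1{uv}\right)_n\left(-\frac{1}{Efu^2v};\frac1{uv}\right)_n}} . \end{aligned} $$ -/

import Mathlib

open Filter Topology

noncomputable section

/-- The infinite continued fraction `[b; a 0, a 1, a 2, …]` with all partial numerators equal to
`1`, as a Mathlib continued fraction over `ℝ`. -/
def simpleCF (b : ℤ) (a : ℕ → ℤ) : GenContFract ℝ :=
  ⟨(b : ℝ), Stream'.Seq.ofStream fun k => ⟨1, (a k : ℝ)⟩⟩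

/-- The `n`-th block (of length 24) of partial quotients. -/
def tasoevBlock (e f p q r u v : ℤ) (n : ℕ) : Fin 24 → ℤ :=
  ![r - 1, 1, q - 1, r, p - 1, 1, r - 1, q - 1, 1, r - 1, e * u ^ n - 1, 1,
    r - 2, 1, q - 1, r - 1, 1, p - 1, r, q - 1, 1, r - 2, 1, f * v ^ n - 1]

/-- The blocks number `1, 2, 3, …` written one after the other. -/
def tasoevQuotient (e f p q r u v : ℤ) (k : ℕ) : ℤ :=
  tasoevBlock e f p q r u v (k / 24 + 1) ⟨k % 24, Nat.mod_lt k (by norm_num)⟩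

/-- The `q`-shifted factorial `(z; q)_n = ∏_{k < n} (1 - z q ^ k)`. -/
def qShifted (z q : ℝ) (n : ℕ) : ℝ :=
  ∏ k ∈ Finset.range n, (1 - z * q ^ k)

/-- The `n`-th term of the series in the numerator. -/
def numTerm (e f u v : ℝ) (n : ℕ) : ℝ :=
  (e * f) ^ (-(n : ℤ)) * (u * v) ^ (-((n * (n + 3) / 2 : ℕ) : ℤ)) /
    (qShifted (1 / (u * v)) (1 / (u * v)) n *
      qShifted (-1 / (e * f * u ^ 3 * v ^ 2)) (1 / (u * v)) n)

/-- The `n`-th term of the series in the denominator. -/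
def denTerm (e f u v : ℝ) (n : ℕ) : ℝ :=
  (e * f) ^ (-(n : ℤ)) * (u * v) ^ (-((n * (n + 1) / 2 : ℕ) : ℤ)) /
    (qShifted (1 / (u * v)) (1 / (u * v)) n *
      qShifted (-1 / (e * f * u ^ 2 * v)) (1 / (u * v)) n)

/-- The value `1/(eu) - (1/(e²fu²v + e)) · (∑ numTerm) / (∑ denTerm)`. -/
def tasoevValue (e f u v : ℝ) : ℝ :=
  1 / (e * u) - 1 / (e ^ 2 * f * u ^ 2 * v + e) *
    ((∑' n, numTerm e f u v n) / (∑' n, denTerm e f u v n))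

end

/-! Put `B = 1/(pq²r⁴) + 1/(qr²) + 1/r`. Composing the 24 maps `z ↦ 1/(a + z)` of block `n` sends `B
+ y` to `B + 1/(E uⁿ + 1/(f vⁿ + y))` (`foldr_foldedBlock`). Blocks thus act on `y` as two quotients
of the short fraction `[0; Eu, fv, Eu², fv², …]`, with `B` merely carried along.

The short fraction is evaluated by `tasoevValue_eq`: `tasoevValue` satisfies `w(e, f) = 1/(eu +
1/(fv + w(eu, fv)))`, which amounts to a three-term relation between `q`-series
(`tsum_heineTerm_relation`). Together these write the claimed value as the fraction cut after any
number of blocks with a positive remainder, and `tendsto_convs_simpleCF` shows that such a number is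
the limit of the convergents. -/

/-! ### Simple continued fractions with positive partial quotients -/

/-- The value of `1/(a 0 + 1/(a 1 + ⋯ + 1/(a (k-1) + x)))`. -/
noncomputable def cfTail (a : ℕ → ℝ) : ℕ → ℝ → ℝ
  | 0, x => x
  | k + 1, x => cfTail a k (1 / (a k + x))

lemma cfTail_add (a : ℕ → ℝ) (m k : ℕ) (x : ℝ) :
    cfTail a (m + k) x = cfTail a m (cfTail (fun i => a (m + i)) k x) := by
  induction k generalizing x with
  | zero => rfl
  | succ k ih => exact ih _

lemma cfTail_nonneg {a : ℕ → ℝ} (ha : ∀ k, 0 < a k) (k : ℕ) {x : ℝ} (hx : 0 ≤ x) :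
    0 ≤ cfTail a k x := by
  induction k generalizing x with
  | zero => exact hx
  | succ k ih => exact ih (by have := ha k; positivity)

lemma contsAux_simpleCF_add_two (b : ℤ) (a : ℕ → ℤ) (k : ℕ) :
    (simpleCF b a).contsAux (k + 2) =
      ⟨a k * ((simpleCF b a).contsAux (k + 1)).a + ((simpleCF b a).contsAux k).a,
        a k * ((simpleCF b a).contsAux (k + 1)).b + ((simpleCF b a).contsAux k).b⟩ := by
  have h : (simpleCF b a).s.get? k = some ⟨1, (a k : ℝ)⟩ := rfl
  rw [GenContFract.contsAux_recurrence h rfl rfl]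
  simp

lemma contsAux_simpleCF_det (b : ℤ) (a : ℕ → ℤ) (k : ℕ) :
    |((simpleCF b a).contsAux (k + 1)).a * ((simpleCF b a).contsAux k).b -
      ((simpleCF b a).contsAux k).a * ((simpleCF b a).contsAux (k + 1)).b| = 1 := by
  induction k with
  | zero => simp
  | succ k ih =>
    rw [contsAux_simpleCF_add_two, ← ih, ← abs_neg]
    congr 1
    ring

/-- Linear growth of the denominators suffices for convergence. The auxiliary continuants start one
index early, at `(1, 0)`. -/
lemma contsAux_simpleCF_b_bounds (b : ℤ) {a : ℕ → ℤ} (ha : ∀ k, 0 < a k) (k : ℕ) :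
    1 ≤ ((simpleCF b a).contsAux (k + 1)).b ∧
      (k : ℝ) + 1 ≤ ((simpleCF b a).contsAux (k + 2)).b := by
  induction k with
  | zero =>
    rw [contsAux_simpleCF_add_two]
    simpa using mod_cast ha 0
  | succ k ih =>
    have hk : (1 : ℝ) ≤ a (k + 1) := by exact_mod_cast ha (k + 1)
    have hk0 : (0 : ℝ) ≤ k := k.cast_nonneg
    refine ⟨by linarith [ih.2], ?_⟩
    rw [contsAux_simpleCF_add_two]
    push_cast
    nlinarith [ih.1, ih.2]

/-- A finite continued fraction expressed through the continuants. -/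
lemma cfTail_mul_eq {a : ℕ → ℤ} (ha : ∀ k, 0 < a k) (k : ℕ) {x : ℝ} (hx : 0 ≤ x) :
    cfTail (fun i => (a i : ℝ)) k x *
      (((simpleCF 0 a).contsAux (k + 1)).b + x * ((simpleCF 0 a).contsAux k).b) =
    ((simpleCF 0 a).contsAux (k + 1)).a + x * ((simpleCF 0 a).contsAux k).a := by
  induction k generalizing x with
  | zero => simp [cfTail, simpleCF]
  | succ k ih =>
    have hk : (0 : ℝ) < a k := by exact_mod_cast ha k
    have hy : 0 < (a k : ℝ) + x := by linarith
    have := ih (x := 1 / (a k + x)) (by positivity)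
    rw [contsAux_simpleCF_add_two]
    simp only [cfTail]
    field_simp at this
    linear_combination this

/-- If `x` is, for every `k`, the value of the continued fraction cut off after `k` partial
quotients with a nonnegative remainder, then the convergents tend to `x`. -/
lemma tendsto_convs_simpleCF {a : ℕ → ℤ} (ha : ∀ k, 0 < a k) {x : ℝ}
    (hx : ∀ k, ∃ t, 0 ≤ t ∧ x = cfTail (fun i => (a i : ℝ)) k t) :
    Tendsto (simpleCF 0 a).convs atTop (𝓝 x) := by
  refine tendsto_iff_dist_tendsto_zero.2 ?_
  rw [← tendsto_add_atTop_iff_nat 1]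
  refine squeeze_zero (fun _ => dist_nonneg) (fun k => ?_)
    tendsto_one_div_add_atTop_nhds_zero_nat
  obtain ⟨t, ht, hxt⟩ := hx (k + 1)
  have hmul := cfTail_mul_eq ha (k + 1) ht
  rw [← hxt] at hmul
  have hdet := contsAux_simpleCF_det 0 a (k + 1)
  obtain ⟨h1, h3⟩ := contsAux_simpleCF_b_bounds 0 ha k
  have hk0 : (0 : ℝ) ≤ k := k.cast_nonneg
  rw [GenContFract.conv_eq_conts_a_div_conts_b, GenContFract.nth_cont_eq_succ_nth_contAux,
    Real.dist_eq]
  generalize ((simpleCF 0 a).contsAux (k + 2)).a = A at *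
  generalize ((simpleCF 0 a).contsAux (k + 2)).b = B at *
  generalize ((simpleCF 0 a).contsAux (k + 1)).a = A' at *
  generalize ((simpleCF 0 a).contsAux (k + 1)).b = B' at *
  have hB : 0 < B := by linarith
  have hD : 0 < B + t * B' := by nlinarith
  -- Here `x = (A + tA')/(B + tB')`, so the determinant gives error `t/(B(B + tB'))`. As `B' ≥ 1`,
  -- this is at most `1/B`.
  have hxe : A / B - x = t * (A * B' - A' * B) / (B * (B + t * B')) := by
    rw [eq_div_of_mul_eq hD.ne' hmul]
    field_simp
    ring
  rw [hxe, abs_div, abs_mul, hdet, abs_of_nonneg ht, abs_of_pos (mul_pos hB hD), mul_one,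
    div_le_div_iff₀ (mul_pos hB hD) (by positivity)]
  nlinarith [mul_nonneg ht (sub_nonneg.2 h1), mul_nonneg ht (sub_nonneg.2 h3),
    mul_nonneg (mul_nonneg ht hB.le) (sub_nonneg.2 h1), mul_pos hB hB]

/-! ### Evaluation of a finite continued fraction as a quotient -/

/-- Numerator and denominator of `1/(a₁ + 1/(a₂ + ⋯ + 1/(aₖ + n/d)))`. -/
noncomputable def cfFrac (n d : ℝ) (l : List ℝ) : ℝ × ℝ :=
  l.foldr (fun a z => (z.2, a * z.2 + z.1)) (n, d)

lemma foldr_eq_cfFrac {n d : ℝ} (hn : 0 ≤ n) (hd : 0 < d) (l : List ℝ) (hl : ∀ a ∈ l, 0 < a) :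
    0 ≤ (cfFrac n d l).1 ∧ 0 < (cfFrac n d l).2 ∧
      l.foldr (fun a z => 1 / (a + z)) (n / d) = (cfFrac n d l).1 / (cfFrac n d l).2 := by
  induction l with
  | nil => exact ⟨hn, hd, rfl⟩
  | cons a l ih =>
    obtain ⟨h1, h2, h3⟩ := ih fun b hb => hl b (List.mem_cons_of_mem _ hb)
    have ha := hl a List.mem_cons_self
    have h4 : 0 < a * (cfFrac n d l).2 + (cfFrac n d l).1 := by positivity
    refine ⟨h2.le, h4, ?_⟩
    change 1 / (a + l.foldr (fun a z => 1 / (a + z)) (n / d)) =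
      (cfFrac n d l).2 / (a * (cfFrac n d l).2 + (cfFrac n d l).1)
    rw [h3]
    field_simp

lemma cfFrac_append (n d : ℝ) (l l' : List ℝ) :
    cfFrac n d (l ++ l') = cfFrac (cfFrac n d l').1 (cfFrac n d l').2 l :=
  List.foldr_append

/-- The block with middle quotient `e - 1` and last quotient `f - 1`, as a list. -/
noncomputable def foldedBlock (e f p q r : ℝ) : List ℝ :=
  [r - 1, 1, q - 1, r, p - 1] ++ ([1, r - 1, q - 1, 1, r - 1, e - 1] ++
    ([1, r - 2, 1, q - 1, r - 1, 1, p - 1] ++ [r, q - 1, 1, r - 2, 1, f - 1]))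

/-- Working with unreduced numerator-denominator pairs turns the folding into polynomial identities,
free of division. -/
lemma cfFrac_foldedBlock (e f p q r y : ℝ) :
    cfFrac (1 + p * q * r ^ 2 + p * q ^ 2 * r ^ 3 + y * (p * q ^ 2 * r ^ 4)) (p * q ^ 2 * r ^ 4)
      (foldedBlock e f p q r) =
    ((1 + p * q * r ^ 2 + p * q ^ 2 * r ^ 3) * (e * (p ^ 2 * q ^ 4 * r ^ 8) * (f + y) + 1) +
        (p * q ^ 2 * r ^ 4) * (f + y),
      (p * q ^ 2 * r ^ 4) * (e * (p ^ 2 * q ^ 4 * r ^ 8) * (f + y) + 1)) := by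
  -- The innermost sum `f - 1 + (B + y)` depends on `f` and `y` only through `F = f + y`.
  obtain ⟨F, rfl⟩ : ∃ F, F - f = y := ⟨f + y, by ring⟩
  -- The numbers 18, 11 and 5 count the quotients of the block still to be applied.
  have h18 : cfFrac (1 + p * q * r ^ 2 + p * q ^ 2 * r ^ 3 + (F - f) * (p * q ^ 2 * r ^ 4))
      (p * q ^ 2 * r ^ 4) [r, q - 1, 1, r - 2, 1, f - 1] =
      (p * q^3 * r^5 * F - p * q^2 * r^4 * F - p * q * r^2 + q * r - 1,
        p * q^3 * r^6 * F + q * r^2) := by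
    simp only [cfFrac, List.foldr, Prod.mk.injEq]
    constructor <;> ring
  have h11 : cfFrac (p * q^3 * r^5 * F - p * q^2 * r^4 * F - p * q * r^2 + q * r - 1)
      (p * q^3 * r^6 * F + q * r^2) [1, r - 2, 1, q - 1, r - 1, 1, p - 1] =
      (p^2 * q^4 * r^8 * F - p^2 * q^4 * r^7 * F - p^2 * q^3 * r^6 * F + p * q^2 * r^4 * F + 1,
        p^2 * q^4 * r^8 * F) := by
    simp only [cfFrac, List.foldr, Prod.mk.injEq]
    constructor <;> ring
  have h5 : cfFrac
      (p^2 * q^4 * r^8 * F - p^2 * q^4 * r^7 * F - p^2 * q^3 * r^6 * F + p * q^2 * r^4 * F + 1)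
      (p^2 * q^4 * r^8 * F) [1, r - 1, q - 1, 1, r - 1, e - 1] =
      (p^2 * q^5 * r^10 * e * F - p^2 * q^5 * r^9 * e * F + p^2 * q^4 * r^8 * e * F
          - p^2 * q^3 * r^6 * F + p * q^3 * r^6 * F - p * q^3 * r^5 * F + p * q^2 * r^4 * F
          + q * r^2 - q * r + 1,
        p^2 * q^5 * r^10 * e * F + p * q^3 * r^6 * F + q * r^2) := by
    simp only [cfFrac, List.foldr, Prod.mk.injEq]
    constructor <;> ring
  rw [foldedBlock, cfFrac_append, cfFrac_append, cfFrac_append, h18, h11, h5]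
  simp only [cfFrac, List.foldr, Prod.mk.injEq]
  constructor <;> ring

lemma foldedBlock_pos {e f p q r : ℝ} (he : 1 < e) (hf : 1 < f) (hp : 1 < p) (hq : 1 < q)
    (hr : 2 < r) : ∀ a ∈ foldedBlock e f p q r, 0 < a := by
  simp only [foldedBlock, List.cons_append, List.nil_append, List.forall_mem_cons]
  and_intros <;> first | linarith | simp

lemma foldr_foldedBlock {e f p q r y : ℝ} (he : 1 < e) (hf : 1 < f) (hp : 1 < p) (hq : 1 < q)
    (hr : 2 < r) (hy : 0 < y) :
    (foldedBlock e f p q r).foldr (fun a z => 1 / (a + z))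
        (1 / (p * q ^ 2 * r ^ 4) + 1 / (q * r ^ 2) + 1 / r + y) =
      1 / (p * q ^ 2 * r ^ 4) + 1 / (q * r ^ 2) + 1 / r +
        1 / (e * (p ^ 2 * q ^ 4 * r ^ 8) + 1 / (f + y)) := by
  have h : 1 / (p * q ^ 2 * r ^ 4) + 1 / (q * r ^ 2) + 1 / r + y =
      (1 + p * q * r ^ 2 + p * q ^ 2 * r ^ 3 + y * (p * q ^ 2 * r ^ 4)) /
        (p * q ^ 2 * r ^ 4) := by
    field_simp
  rw [h, (foldr_eq_cfFrac (by positivity) (by positivity) _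
    (foldedBlock_pos he hf hp hq hr)).2.2, cfFrac_foldedBlock]
  have h3 : 0 < f + y := by linarith
  field_simp

/-! ### The `q`-series -/

lemma qShifted_succ (z x : ℝ) (n : ℕ) :
    qShifted z x (n + 1) = qShifted z x n * (1 - z * x ^ n) :=
  Finset.prod_range_succ _ _

lemma qShifted_succ' (z x : ℝ) (n : ℕ) :
    qShifted z x (n + 1) = (1 - z) * qShifted (z * x) x n := by
  simp only [qShifted]
  rw [Finset.prod_range_succ', mul_comm]
  simp only [pow_zero, mul_one, pow_succ']
  congr 1
  exact Finset.prod_congr rfl fun k _ => by ring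

lemma qShifted_self_pos {x : ℝ} (h0 : 0 < x) (h1 : x < 1) (n : ℕ) : 0 < qShifted x x n :=
  Finset.prod_pos fun k _ => by
    rw [← pow_succ']
    exact sub_pos.2 (pow_lt_one₀ h0.le h1 k.succ_ne_zero)

lemma qShifted_neg_pos {c x : ℝ} (hc : 0 < c) (h0 : 0 < x) (n : ℕ) : 0 < qShifted (-c) x n :=
  Finset.prod_pos fun k _ => by
    have : 0 < c * x ^ k := by positivity
    linarith

/-- The general term of `∑ tᵏ x^{k(k+1)/2} / ((x; x)ₖ (-c; x)ₖ)`. -/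
noncomputable def heineTerm (x t c : ℝ) (k : ℕ) : ℝ :=
  t ^ k * x ^ (k * (k + 1) / 2) / (qShifted x x k * qShifted (-c) x k)

lemma triangle_succ (k : ℕ) : (k + 1) * (k + 1 + 1) / 2 = k * (k + 1) / 2 + (k + 1) := by
  rw [show (k + 1) * (k + 1 + 1) = k * (k + 1) + (k + 1) * 2 by ring,
    Nat.add_mul_div_right _ _ two_pos]

lemma heineTerm_pos {x t c : ℝ} (h0 : 0 < x) (h1 : x < 1) (ht : 0 < t) (hc : 0 < c) (k : ℕ) :
    0 < heineTerm x t c k := by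
  have := qShifted_self_pos h0 h1 k
  have := qShifted_neg_pos hc h0 k
  unfold heineTerm
  positivity

lemma heineTerm_succ (x t c : ℝ) (k : ℕ) :
    heineTerm x t c (k + 1) =
      t * x ^ (k + 1) / ((1 - x ^ (k + 1)) * (1 + c * x ^ k)) * heineTerm x t c k := by
  rw [heineTerm, heineTerm, qShifted_succ, qShifted_succ, triangle_succ, ← pow_succ', neg_mul,
    sub_neg_eq_add, div_mul_div_comm]
  congr 1 <;> ring

lemma summable_heineTerm {x t c : ℝ} (h0 : 0 < x) (h1 : x < 1) (ht : 0 < t) (hc : 0 < c) :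
    Summable (heineTerm x t c) := by
  refine summable_of_ratio_test_tendsto_lt_one (l := 0) one_pos
    (Eventually.of_forall fun k => (heineTerm_pos h0 h1 ht hc k).ne') ?_
  have hx := tendsto_pow_atTop_nhds_zero_of_lt_one h0.le h1
  have hx' := (tendsto_add_atTop_iff_nat 1).2 hx
  have key : Tendsto (fun k : ℕ => t * x ^ (k + 1) / ((1 - x ^ (k + 1)) * (1 + c * x ^ k)))
      atTop (𝓝 0) := by
    have := (hx'.const_mul t).div ((hx'.const_sub 1).mul ((hx.const_mul c).const_add 1))
      (by norm_num)
    simpa [Pi.div_def] using this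
  refine key.congr fun k => ?_
  have h2 := heineTerm_pos h0 h1 ht hc k
  rw [Real.norm_of_nonneg h2.le, Real.norm_of_nonneg (heineTerm_pos h0 h1 ht hc _).le,
    heineTerm_succ, mul_div_cancel_right₀ _ h2.ne']

lemma tsum_heineTerm_pos {x t c : ℝ} (h0 : 0 < x) (h1 : x < 1) (ht : 0 < t) (hc : 0 < c) :
    0 < ∑' k, heineTerm x t c k :=
  (summable_heineTerm h0 h1 ht hc).tsum_pos (fun k => (heineTerm_pos h0 h1 ht hc k).le) 0
    (heineTerm_pos h0 h1 ht hc 0)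

/-- Over a common denominator the bracket is `(1 + c x^(k+1)) - x^(k+1) (1 + c) = 1 - x^(k+1)`,
which cancels the last factor of `(x; x)_{k+1}` and lowers the index. -/
lemma heineTerm_succ_sub {x t c : ℝ} (h0 : 0 < x) (h1 : x < 1) (hc : 0 < c) (k : ℕ) :
    heineTerm x t c (k + 1) - heineTerm x (t * x) (c * x) (k + 1) =
      t * x / ((1 + c) * (1 + c * x)) * heineTerm x (t * x) (c * x * x) k := by
  have hS := qShifted_neg_pos (show 0 < c * x * x by positivity) h0 k
  have hP := qShifted_self_pos h0 h1 k
  have hk : 0 < 1 - x ^ (k + 1) := sub_pos.2 (pow_lt_one₀ h0.le h1 k.succ_ne_zero)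
  have e1 : qShifted x x (k + 1) = qShifted x x k * (1 - x ^ (k + 1)) := by
    rw [qShifted_succ, pow_succ']
  have e2 : qShifted (-(c * x)) x (k + 1) = (1 + c * x) * qShifted (-(c * x * x)) x k := by
    rw [qShifted_succ', neg_mul, sub_neg_eq_add]
  have e3 : qShifted (-c) x (k + 1) =
      (1 + c) * (1 + c * x) * qShifted (-(c * x * x)) x k / (1 + c * x ^ (k + 1)) := by
    rw [eq_div_iff (by positivity)]
    have := qShifted_succ (-c) x (k + 1)
    rw [qShifted_succ', neg_mul, e2] at this
    linear_combination -this
  simp only [heineTerm, e1, e2, e3, triangle_succ]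
  generalize qShifted (-(c * x * x)) x k = S at *
  generalize qShifted x x k = P at *
  have hk' := hk.ne'
  field_simp
  ring

/-- The left side is `1 + c x^k` times its first term, and `(-c; x)_k (1 + c x^k) = (1 + c) (-cx;
x)_k`. -/
lemma heineTerm_add {x t c : ℝ} (h0 : 0 < x) (h1 : x < 1) (hc : 0 < c) (k : ℕ) :
    heineTerm x t (c * x) k + c * heineTerm x (t * x) (c * x) k =
      (1 + c) * heineTerm x t c k := by
  have hS := qShifted_neg_pos (show 0 < c * x by positivity) h0 k
  have hP := qShifted_self_pos h0 h1 k
  have e : qShifted (-c) x k = (1 + c) * qShifted (-(c * x)) x k / (1 + c * x ^ k) := by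
    rw [eq_div_iff (by positivity)]
    have := qShifted_succ (-c) x k
    rw [qShifted_succ', neg_mul] at this
    linear_combination -this
  simp only [heineTerm, e]
  field_simp
  ring

/-- The three-term relation between `∑ heineTerm` at `(t, c)`, `(t x, c x)` and `(t x², c x²)`,
together with the monotonicity it implies. -/
lemma tsum_heineTerm_relation {x t c : ℝ} (h0 : 0 < x) (h1 : x < 1) (ht : 0 < t) (hc : 0 < c) :
    (∑' k, heineTerm x (t * x) (c * x) k < ∑' k, heineTerm x t c k) ∧
    ((∑' k, heineTerm x t c k) - ∑' k, heineTerm x (t * x) (c * x) k) *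
        ((1 + c) * (1 + c * x)) =
      t * x * ((1 + c * x) * (∑' k, heineTerm x (t * x) (c * x) k) -
        c * x * ∑' k, heineTerm x (t * x * x) (c * x * x) k) := by
  have s0 := summable_heineTerm h0 h1 ht hc
  have s1 := summable_heineTerm h0 h1 (show 0 < t * x by positivity)
    (show 0 < c * x by positivity)
  have s2 := summable_heineTerm h0 h1 (show 0 < t * x * x by positivity)
    (show 0 < c * x * x by positivity)
  have s3 := summable_heineTerm h0 h1 (show 0 < t * x by positivity)
    (show 0 < c * x * x by positivity)
  have hpos := tsum_heineTerm_pos h0 h1 (show 0 < t * x by positivity)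
    (show 0 < c * x * x by positivity)
  -- The terms at `k = 0` are both 1 and cancel. The mixed sum at `(tx, cx²)` is then eliminated by
  -- means of `hB`.
  have hA : (∑' k, heineTerm x t c k) - ∑' k, heineTerm x (t * x) (c * x) k =
      t * x / ((1 + c) * (1 + c * x)) * ∑' k, heineTerm x (t * x) (c * x * x) k := by
    rw [← s0.tsum_sub s1, (s0.sub s1).tsum_eq_zero_add, ← tsum_mul_left]
    simp only [heineTerm_succ_sub h0 h1 hc]
    simp [heineTerm, qShifted]
  have hB : (∑' k, heineTerm x (t * x) (c * x * x) k) +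
      c * x * (∑' k, heineTerm x (t * x * x) (c * x * x) k) =
      (1 + c * x) * ∑' k, heineTerm x (t * x) (c * x) k := by
    rw [← tsum_mul_left, ← tsum_mul_left, ← s3.tsum_add (s2.mul_left _)]
    exact tsum_congr fun k => heineTerm_add h0 h1 (by positivity) k
  refine ⟨?_, ?_⟩
  · have : 0 < t * x / ((1 + c) * (1 + c * x)) *
        ∑' k, heineTerm x (t * x) (c * x * x) k := by positivity
    linarith
  · rw [hA, ← hB]
    field_simp
    ring

/-! ### The value of the continued fraction -/

lemma denTerm_eq_heineTerm (e f u v : ℝ) :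
    denTerm e f u v = heineTerm (1 / (u * v)) (1 / (e * f)) (1 / (e * f * u ^ 2 * v)) := by
  funext n
  simp only [denTerm, heineTerm, zpow_neg, zpow_natCast, one_div, inv_pow, neg_div]

/-- Replacing `(e, f)` by `(eu, fv)` also multiplies `t` and `c` by `x = 1/(uv)`, so the numerator
series at `(e, f)` is the denominator series at `(eu, fv)`. -/
lemma numTerm_eq_heineTerm (e f u v : ℝ) :
    numTerm e f u v = heineTerm (1 / (u * v)) (1 / (e * f) * (1 / (u * v)))
      (1 / (e * f * u ^ 2 * v) * (1 / (u * v))) := by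
  funext n
  have hn : n * (n + 3) / 2 = n * (n + 1) / 2 + n := by
    rw [show n * (n + 3) = n * (n + 1) + n * 2 by ring, Nat.add_mul_div_right _ _ two_pos]
  have hc : -(1 / (e * f * u ^ 2 * v) * (1 / (u * v))) = -1 / (e * f * u ^ 3 * v ^ 2) := by
    rw [div_mul_div_comm, ← neg_div]
    congr 1 <;> ring
  simp only [numTerm, heineTerm, hc, hn, zpow_neg, zpow_natCast]
  congr 1
  simp only [one_div, mul_pow, inv_pow, pow_add, mul_inv]
  ring

lemma tasoevValue_pos {e f u v : ℝ} (he : 0 < e) (hf : 0 < f) (hu : 1 < u) (hv : 1 < v)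
    (hef : 1 ≤ e * f) : 0 < tasoevValue e f u v := by
  have hx0 : 0 < 1 / (u * v) := by positivity
  have hx1 : 1 / (u * v) < 1 := by
    rw [div_lt_one (by positivity)]
    nlinarith
  have ht : 0 < 1 / (e * f) := by positivity
  have hc : 0 < 1 / (e * f * u ^ 2 * v) := by positivity
  have hrel := (tsum_heineTerm_relation hx0 hx1 ht hc).1
  have hD := tsum_heineTerm_pos hx0 hx1 ht hc
  rw [tasoevValue, denTerm_eq_heineTerm, numTerm_eq_heineTerm, sub_pos]
  have h1 := (div_lt_one hD).2 hrel
  refine (mul_lt_of_lt_one_right (by positivity) h1).trans ?_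
  apply one_div_lt_one_div_of_lt (by positivity)
  have h2 : u < e * f * (u ^ 2 * v) := by
    nlinarith [mul_pos (mul_pos (show 0 < u by linarith) (show 0 < u by linarith))
      (sub_pos.2 hv), mul_nonneg (sub_nonneg.2 hef) (show 0 ≤ u ^ 2 * v by positivity)]
  nlinarith [mul_lt_mul_of_pos_left h2 he]

lemma tasoevValue_eq {e f u v : ℝ} (he : 0 < e) (hf : 0 < f) (hu : 1 < u) (hv : 1 < v)
    (hef : 1 ≤ e * f) :
    tasoevValue e f u v = 1 / (e * u + 1 / (f * v + tasoevValue (e * u) (f * v) u v)) := by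
  have hx0 : 0 < 1 / (u * v) := by positivity
  have hx1 : 1 / (u * v) < 1 := by
    rw [div_lt_one (by positivity)]
    nlinarith
  have ht : 0 < 1 / (e * f) := by positivity
  have hc : 0 < 1 / (e * f * u ^ 2 * v) := by positivity
  have hrel := (tsum_heineTerm_relation hx0 hx1 ht hc).2
  have hD := tsum_heineTerm_pos hx0 hx1 ht hc
  have hD1 := tsum_heineTerm_pos hx0 hx1 (mul_pos ht hx0) (mul_pos hc hx0)
  have hy : 0 < tasoevValue (e * u) (f * v) u v := by
    refine tasoevValue_pos (by positivity) (by positivity) hu hv ?_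
    have : 1 ≤ u * v := by nlinarith
    nlinarith [mul_nonneg (sub_nonneg.2 hef) (sub_nonneg.2 this)]
  have et : 1 / (e * u * (f * v)) = 1 / (e * f) * (1 / (u * v)) := by
    rw [div_mul_div_comm]
    congr 1 <;> ring
  have ec : 1 / (e * u * (f * v) * u ^ 2 * v) = 1 / (e * f * u ^ 2 * v) * (1 / (u * v)) := by
    rw [div_mul_div_comm]
    congr 1 <;> ring
  rw [eq_div_iff (by positivity), ← sub_eq_zero]
  set y := tasoevValue (e * u) (f * v) u v with hydef
  have hfy : f * v + y ≠ 0 := by positivity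
  suffices h : tasoevValue e f u v * (e * u * (f * v + y) + 1) = f * v + y by
    field_simp
    linear_combination h
  rw [tasoevValue, denTerm_eq_heineTerm, numTerm_eq_heineTerm, et, ec] at hydef
  rw [tasoevValue, denTerm_eq_heineTerm, numTerm_eq_heineTerm, hydef]
  clear_value y
  clear hydef hfy hy et ec
  generalize (∑' k, heineTerm (1 / (u * v)) (1 / (e * f)) (1 / (e * f * u ^ 2 * v)) k) = D at *
  generalize (∑' k, heineTerm (1 / (u * v)) (1 / (e * f) * (1 / (u * v)))
    (1 / (e * f * u ^ 2 * v) * (1 / (u * v))) k) = D1 at *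
  generalize (∑' k, heineTerm (1 / (u * v)) (1 / (e * f) * (1 / (u * v)) * (1 / (u * v)))
    (1 / (e * f * u ^ 2 * v) * (1 / (u * v)) * (1 / (u * v))) k) = D2 at *
  -- The goal multiplied by `D` and rearranged: `w D = eu/(e²fu²v + e) · (fv + y) D1`, where `w` is
  -- the value at `(e, f)` and `y` the one at `(eu, fv)`.
  have key : D / (e * u) - D1 / (e ^ 2 * f * u ^ 2 * v + e) - e * u / (e ^ 2 * f * u ^ 2 * v + e) *
      (f * v * D1 + D1 / (e * u * u) -
        1 / ((e * u) ^ 2 * (f * v) * u ^ 2 * v + e * u) * D2) = 0 := by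
    field_simp at hrel ⊢
    linear_combination hrel
  have hm : e ^ 2 * f * u ^ 2 * v + e ≠ 0 := by positivity
  have hm' : (e * u) ^ 2 * (f * v) * u ^ 2 * v + e * u ≠ 0 := by positivity
  generalize e ^ 2 * f * u ^ 2 * v + e = S at *
  generalize (e * u) ^ 2 * (f * v) * u ^ 2 * v + e * u = S' at *
  field_simp at key ⊢
  linear_combination u * D1 * key

/-! ### The partial quotients -/

lemma one_lt_mul_pow_succ {e u : ℤ} (he : 0 < e) (hu : 1 < u) (n : ℕ) : 1 < e * u ^ (n + 1) := by
  have h : 1 < u ^ (n + 1) := one_lt_pow₀ hu n.succ_ne_zero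
  nlinarith

lemma tasoevQuotient_pos {e f p q r u v : ℤ} (he : 0 < e) (hf : 0 < f) (hp : 1 < p) (hq : 1 < q)
    (hr : 2 < r) (hu : 1 < u) (hv : 1 < v) (k : ℕ) : 0 < tasoevQuotient e f p q r u v k := by
  have h1 := one_lt_mul_pow_succ he hu (k / 24)
  have h2 := one_lt_mul_pow_succ hf hv (k / 24)
  unfold tasoevQuotient
  generalize (⟨k % 24, Nat.mod_lt k (by norm_num)⟩ : Fin 24) = i
  fin_cases i <;> simp [tasoevBlock] <;> linarith

lemma cfTail_tasoevQuotient_block (e f p q r u v : ℤ) (n : ℕ) (x : ℝ) :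
    cfTail (fun i => (tasoevQuotient e f p q r u v (24 * n + i) : ℝ)) 24 x =
      (foldedBlock (e * u ^ (n + 1)) (f * v ^ (n + 1)) p q r).foldr
        (fun a z => 1 / (a + z)) x := by
  have h : ∀ i (hi : i < 24), tasoevQuotient e f p q r u v (24 * n + i) =
      tasoevBlock e f p q r u v (n + 1) ⟨i, hi⟩ := by
    intro i hi
    have h1 : (24 * n + i) / 24 = n := by omega
    have h2 : (24 * n + i) % 24 = i := by omega
    simp only [tasoevQuotient, h1, h2]
  simp only [cfTail, h, foldedBlock, List.cons_append, List.nil_append, List.foldr,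
    Nat.reduceLT]
  simp [tasoevBlock]

theorem mainTheorem4 (e f p q r u v : ℤ) (he : 0 < e) (hf : 0 < f) (hp : 1 < p) (hq : 1 < q)
    (hr : 2 < r) (hu : 1 < u) (hv : 1 < v) (E : ℤ) (hE : E = e * p ^ 2 * q ^ 4 * r ^ 8) :
    (∀ k, 0 < tasoevQuotient e f p q r u v k) ∧
    Summable (numTerm (E : ℝ) f u v) ∧
    Summable (denTerm (E : ℝ) f u v) ∧
    (∑' n, denTerm (E : ℝ) f u v n) ≠ 0 ∧
    Tendsto (simpleCF 0 (tasoevQuotient e f p q r u v)).convs atTop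
      (𝓝 (1 / ((p : ℝ) * q ^ 2 * r ^ 4) + 1 / ((q : ℝ) * r ^ 2) + 1 / (r : ℝ) +
        tasoevValue (E : ℝ) f u v)) := by
  have hpos := tasoevQuotient_pos he hf hp hq hr hu hv
  have hE0 : 0 < E := by rw [hE]; positivity
  have hER : (E : ℝ) = e * ((p : ℝ) ^ 2 * q ^ 4 * r ^ 8) := by
    rw [hE]; push_cast; ring
  have hE1 : (0 : ℝ) < E := by exact_mod_cast hE0
  have hf1 : (0 : ℝ) < f := by exact_mod_cast hf
  have hp1 : (1 : ℝ) < p := by exact_mod_cast hp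
  have hq1 : (1 : ℝ) < q := by exact_mod_cast hq
  have hr1 : (2 : ℝ) < r := by exact_mod_cast hr
  have hu1 : (1 : ℝ) < u := by exact_mod_cast hu
  have hv1 : (1 : ℝ) < v := by exact_mod_cast hv
  have hx0 : 0 < 1 / ((u : ℝ) * v) := by positivity
  have hx1 : 1 / ((u : ℝ) * v) < 1 := by
    rw [div_lt_one (by positivity)]
    nlinarith
  have ht : 0 < 1 / ((E : ℝ) * f) := by positivity
  have hc : 0 < 1 / ((E : ℝ) * f * u ^ 2 * v) := by positivity
  refine ⟨hpos, ?_, ?_, ?_, tendsto_convs_simpleCF hpos fun k => ?_⟩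
  · rw [numTerm_eq_heineTerm]
    exact summable_heineTerm hx0 hx1 (mul_pos ht hx0) (mul_pos hc hx0)
  · rw [denTerm_eq_heineTerm]
    exact summable_heineTerm hx0 hx1 ht hc
  · rw [denTerm_eq_heineTerm]
    exact (tsum_heineTerm_pos hx0 hx1 ht hc).ne'
  set B : ℝ := 1 / ((p : ℝ) * q ^ 2 * r ^ 4) + 1 / ((q : ℝ) * r ^ 2) + 1 / (r : ℝ)
  -- `y n` is the tail of the short fraction after `2n` quotients.
  set y : ℕ → ℝ := fun n => tasoevValue (E * u ^ n) (f * v ^ n) u v with hy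
  have hpow : ∀ n : ℕ, 0 < (E : ℝ) * u ^ n ∧ 0 < (f : ℝ) * v ^ n ∧
      1 ≤ (E : ℝ) * u ^ n * (f * v ^ n) := by
    intro n
    refine ⟨by positivity, by positivity, ?_⟩
    -- A positive integer is at least 1.
    have : 0 < E * u ^ n * (f * v ^ n) := by positivity
    exact_mod_cast this
  have hypos : ∀ n, 0 < y n := fun n =>
    tasoevValue_pos (hpow n).1 (hpow n).2.1 hu1 hv1 (hpow n).2.2
  have hyrec : ∀ n, y n = 1 / (E * u ^ (n + 1) + 1 / (f * v ^ (n + 1) + y (n + 1))) := by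
    intro n
    simp only [hy]
    rw [tasoevValue_eq (hpow n).1 (hpow n).2.1 hu1 hv1 (hpow n).2.2]
    simp only [pow_succ, mul_assoc]
  have hblock : ∀ n, B + tasoevValue E f u v =
      cfTail (fun i => (tasoevQuotient e f p q r u v i : ℝ)) (24 * n) (B + y n) := by
    intro n
    induction n with
    | zero => simp [cfTail, hy]
    | succ n ih =>
      have h1 : (1 : ℝ) < e * u ^ (n + 1) := by exact_mod_cast one_lt_mul_pow_succ he hu n
      have h2 : (1 : ℝ) < f * v ^ (n + 1) := by exact_mod_cast one_lt_mul_pow_succ hf hv n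
      rw [ih, mul_add, mul_one, cfTail_add, cfTail_tasoevQuotient_block,
        foldr_foldedBlock h1 h2 hp1 hq1 hr1 (hypos (n + 1)), hyrec n, hER, mul_right_comm (e : ℝ)]
  -- Since `24k ≥ k`, a cut after `k` quotients is obtained from the cut after `k` blocks by
  -- absorbing the other `23k` quotients into the remainder.
  obtain ⟨j, hj⟩ : ∃ j, 24 * k = k + j := ⟨23 * k, by ring⟩
  refine ⟨cfTail (fun i => (tasoevQuotient e f p q r u v (k + i) : ℝ)) j (B + y k),
    cfTail_nonneg (fun i => by exact_mod_cast hpos _) j ?_, ?_⟩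
  · have := hypos k
    positivity
  · rw [hblock k, hj, cfTail_add]
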